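/- Let $H\in\mathbb R^{n\times n}$, $f\in\mathbb R^n$, $A\in\mathbb R^{m\times n}$, $b\in\mathbb R^m$ and $\rho>0$, and let $\mathcal X=\{x\in\mathbb R^n: Ax\le b\}$ be nonempty. The affine variational inequality (AVI) asks for $x\in\mathcal X$ with $(Hx+f)^\top(y-x)\ge 0$ for all $y\in\mathcal X$; its KKT conditions are $Hx+f+A^\top\lambda=0$, $0\le\lambda\perp b-Ax\ge 0$. For $x\in\mathbb R^n$ write $\mathcal A(x)=\{i: A_ix=b_i\}$, and let $A_S,b_S$ denote the rows of $A$ and entries of $b$ with index in $S\subseteq\{1,\dots,m\}$. Put $H_s=\tfrac12(H+H^\top)$, $\tilde H=\rho I+H_s$, $\tilde f(z)=f+(H-\tilde H)z$, and let $\mathrm{QP}(z)$ be the problem of minimizing $\tfrac12x^\top\tilde Hx+\tilde f(z)^\top x$ subject to $Ax\le b$. Consider the following algorithm (DR-DAQP), started from an arbitrary $z_0\in\mathbb R^n$ with $\delta=\infty$ and with $\mathcal A_{-1}$ either undefined (so that the test in step 2 fails for $k=0$) or an arbitrary index set. For $k=0,1,2,\dots$: 1. Let $y_k$ be the solution of $\mathrm{QP}(z_k)$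 and $\mathcal A_k=\mathcal A(y_k)$. 2. If $\mathcal A_k=\mathcal A_{k-1}$: (a) let $(\tilde z_k,\lambda_k)$ be a solution of the linear system $H\tilde z+A_{S}^\top\lambda=-f$, $A_{S}\tilde z=b_{S}$ with $S=\mathcal A_k$; (b) if $\lambda_k\ge0$ and $A\tilde z_k\le b$, return $(\tilde z_k,\lambda_k)$, where $\lambda_k$ is extended by zero to the indices outside $S$; (c) otherwise let $\tilde y_k$ be the solution of $\mathrm{QP}(\tilde z_k)$ and overwrite $\mathcal A_k\leftarrow\mathcal A(\tilde y_k)$; if $\|\tilde y_k-\tilde z_k\|<\delta$ (Euclidean norm), set $y_k\leftarrow\tilde y_k$, $z_k\leftarrow\tilde z_k$, $\delta\leftarrow\|\tilde y_k-\tilde z_k\|$. 3. Set $z_{k+1}=(\rho I+H)^{-1}\bigl(\rho y_k+Hz_k+\tfrac12H_s(y_k-z_k)\bigr)$. Assume that $H+H^\top$ is positive definite, that the rows of $A_{\mathcal A(x^*)}$ are linearly independent at the solution $x^*$ of the AVI (LICQ), and that the KKT multiplier $\lambda^*$ satisfies $\lambda^*_i>0$ for all $i\in\mathcal A(x^*)$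 (strict complementarity). Then the AVI has exactly one solution $x^*$, there is exactly one pair $(x^*,\lambda^*)$ satisfying the KKT conditions, and for every starting point the algorithm is well defined (every step that is reached can be carried out) and, whichever solutions of the linear systems are computed in step 2(a), it returns exactly $(x^*,\lambda^*)$ after finitely many iterations; their number is bounded by some $N$ depending only on the data and the start $(z_0,\mathcal A_{-1})$. -/

import Mathlib

open scoped Matrix ENNReal

noncomputable section

/-- The data of an affine variational inequality over the polyhedron `{x | A x ≤ b}`. -/
structure AVI (n m : ℕ) where
  H : Matrix (Fin n) (Fin n) ℝ
  f : Fin n → ℝ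
  A : Matrix (Fin m) (Fin n) ℝ
  b : Fin m → ℝ

namespace AVI

variable {n m : ℕ} (P : AVI n m)

/-- The feasible polyhedron `{x | A x ≤ b}` (componentwise order). -/
def feasible : Set (Fin n → ℝ) := {x | P.A *ᵥ x ≤ P.b}

/-- `x` is feasible and `(H x + f)ᵀ (y - x) ≥ 0` for every feasible `y`. -/
def IsSolution (x : Fin n → ℝ) : Prop :=
  x ∈ P.feasible ∧ ∀ y ∈ P.feasible, 0 ≤ (P.H *ᵥ x + P.f) ⬝ᵥ (y - x)

/-- The KKT conditions `H x + f + Aᵀ l = 0` and `0 ≤ l ⟂ b - A x ≥ 0`. -/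
def IsKKT (x : Fin n → ℝ) (l : Fin m → ℝ) : Prop :=
  P.H *ᵥ x + P.f + P.Aᵀ *ᵥ l = 0 ∧
    0 ≤ l ∧ 0 ≤ P.b - P.A *ᵥ x ∧ l ⬝ᵥ (P.b - P.A *ᵥ x) = 0

/-- The indices `i` with `A_i x = b_i`. -/
def activeSet (x : Fin n → ℝ) : Finset (Fin m) :=
  Finset.univ.filter fun i => (P.A *ᵥ x) i = P.b i

/-- The submatrix of `A` made of the rows with index in `S`. -/
def rows (S : Finset (Fin m)) : Matrix S (Fin n) ℝ :=
  P.A.submatrix Subtype.val id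

/-- The rows of `A` that are active at `x` are linearly independent. -/
def LICQ (x : Fin n → ℝ) : Prop :=
  LinearIndependent ℝ (P.rows (P.activeSet x)).row

/-- The symmetric part of `H`. -/
def Hs : Matrix (Fin n) (Fin n) ℝ := (1 / 2 : ℝ) • (P.H + P.Hᵀ)

/-- The Hessian `ρ I + H_s` of the quadratic-program subproblem. -/
def Ht (ρ : ℝ) : Matrix (Fin n) (Fin n) ℝ := ρ • 1 + P.Hs

/-- The linear term `f + (H - (ρ I + H_s)) z` of the quadratic-program subproblem. -/
def ft (ρ : ℝ) (z : Fin n → ℝ) : Fin n → ℝ := P.f + (P.H - P.Ht ρ) *ᵥ z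

/-- The objective of the quadratic-program subproblem with parameter `z`. -/
def qpObj (ρ : ℝ) (z x : Fin n → ℝ) : ℝ :=
  (1 / 2) * (x ⬝ᵥ (P.Ht ρ *ᵥ x)) + P.ft ρ z ⬝ᵥ x

/-- `y` minimizes the objective with parameter `z` over the feasible polyhedron. -/
def IsQPSolution (ρ : ℝ) (z y : Fin n → ℝ) : Prop :=
  y ∈ P.feasible ∧ IsMinOn (P.qpObj ρ z) P.feasible y

/-- `(x, μ)` solves the linear system `[H, A_Sᵀ; A_S, 0] [x; μ] = [-f; b_S]`. -/
def SolvesKKTSystem (S : Finset (Fin m)) (x : Fin n → ℝ) (μ : S → ℝ) : Prop :=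
  Matrix.fromBlocks P.H (P.rows S)ᵀ (P.rows S) 0 *ᵥ Sum.elim x μ =
    Sum.elim (-P.f) (fun i : S => P.b i)

/-- The Douglas-Rachford update `(ρ I + H)⁻¹ (ρ y + H z + (H_s / 2) (y - z))`. -/
def drUpdate (ρ : ℝ) (z y : Fin n → ℝ) : Fin n → ℝ :=
  (ρ • 1 + P.H)⁻¹ *ᵥ (ρ • y + P.H *ᵥ z + ((1 / 2 : ℝ) • P.Hs) *ᵥ (y - z))

/-- The Euclidean norm, as an extended nonnegative real. -/
def euclNorm (v : Fin n → ℝ) : ℝ≥0∞ := ‖WithLp.toLp 2 v‖ₑ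

/-- A vector of multipliers indexed by `S`, extended by zero to all the constraints. -/
def extendZero (S : Finset (Fin m)) (μ : S → ℝ) : Fin m → ℝ :=
  fun i => if h : i ∈ S then μ ⟨i, h⟩ else 0

/-- The variables of the hybrid method at the beginning of an iteration: the iterate `z`, the
active set stored by the previous iteration (`none` if there is none), and the residual `δ` of the
last accepted Newton step. -/
structure State (n m : ℕ) where
  z : Fin n → ℝ
  prev : Option (Finset (Fin m))
  δ : ℝ≥0∞

/-- What one iteration leads to: the method goes on from a new state, or returns a pair. -/
inductive Outcome (n m : ℕ) where
  | next (s : State n m)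
  | done (x : Fin n → ℝ) (l : Fin m → ℝ)

/-- One iteration of the hybrid method. It is a relation because the linear system can have several
solutions `μ` when the selected rows of `A` are dependent; any of them may be the computed one. -/
inductive Step (ρ : ℝ) (s : State n m) : Outcome n m → Prop
  /-- The active set has changed: plain Douglas-Rachford step. -/
  | unstable (y : Fin n → ℝ) (hy : P.IsQPSolution ρ s.z y)
      (hprev : s.prev ≠ some (P.activeSet y)) :
      Step ρ s (.next ⟨P.drUpdate ρ s.z y, some (P.activeSet y), s.δ⟩)
  /-- The active set is stable and the solution of the linear system is primal and dual feasible. -/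
  | terminate (y : Fin n → ℝ) (hy : P.IsQPSolution ρ s.z y)
      (hprev : s.prev = some (P.activeSet y))
      (zt : Fin n → ℝ) (μ : P.activeSet y → ℝ) (hsys : P.SolvesKKTSystem (P.activeSet y) zt μ)
      (hfeas : 0 ≤ μ ∧ P.A *ᵥ zt ≤ P.b) :
      Step ρ s (.done zt (extendZero (P.activeSet y) μ))
  /-- The active set is stable, the candidate is infeasible, the Newton step is accepted. -/
  | accept (y : Fin n → ℝ) (hy : P.IsQPSolution ρ s.z y)
      (hprev : s.prev = some (P.activeSet y))
      (zt : Fin n → ℝ) (μ : P.activeSet y → ℝ) (hsys : P.SolvesKKTSystem (P.activeSet y) zt μ)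
      (hfeas : ¬ (0 ≤ μ ∧ P.A *ᵥ zt ≤ P.b))
      (yt : Fin n → ℝ) (hyt : P.IsQPSolution ρ zt yt) (hδ : euclNorm (yt - zt) < s.δ) :
      Step ρ s (.next ⟨P.drUpdate ρ zt yt, some (P.activeSet yt), euclNorm (yt - zt)⟩)
  /-- The active set is stable, the candidate is infeasible, the Newton step is rejected. The stored
  active set is overwritten by that of the second quadratic program also in this case. -/
  | reject (y : Fin n → ℝ) (hy : P.IsQPSolution ρ s.z y)
      (hprev : s.prev = some (P.activeSet y))
      (zt : Fin n → ℝ) (μ : P.activeSet y → ℝ) (hsys : P.SolvesKKTSystem (P.activeSet y) zt μ)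
      (hfeas : ¬ (0 ≤ μ ∧ P.A *ᵥ zt ≤ P.b))
      (yt : Fin n → ℝ) (hyt : P.IsQPSolution ρ zt yt) (hδ : ¬ euclNorm (yt - zt) < s.δ) :
      Step ρ s (.next ⟨P.drUpdate ρ s.z y, some (P.activeSet yt), s.δ⟩)

/-- Every execution from the given state returns the pair `(x, l)` after at most `N` iterations,
and none of them gets stuck: each iteration that is reached can be carried out. -/
def ReturnsWithin (ρ : ℝ) (x : Fin n → ℝ) (l : Fin m → ℝ) : ℕ → State n m → Prop
  | 0, _ => False
  | N + 1, s =>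
      (∃ o, P.Step ρ s o) ∧
        ∀ o, P.Step ρ s o → o = .done x l ∨ ∃ s', o = .next s' ∧ ReturnsWithin ρ x l N s'

end AVI

end

/-! Solutions of the AVI are the fixed points of the plain Douglas-Rachford map `drMap`. For the
quadratic form `lyapunov`, `lyapunov_drUpdate_add_le` shows that a step shrinks the difference of
two orbits by at least the `H`-forms of the differences of the iterates and of the QP solutions. As
`H` is positive definite, `drMap` contracts geometrically. This gives existence of a solution and,
from any start, convergence of both the iterates and the QP solutions. Under LICQ and strict
complementarity the active set of the QP solution is then eventually the right one
(`IsKKT.eventually_activeSet_eq`), and the linear system at that set yields the KKT pair.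

The Newton steps can disturb this convergence only finitely often. The linear system of an index set
determines the point `x`, though perhaps not the multiplier, so there are finitely many candidates;
an accepted one lowers `δ` strictly to its own residual, so no candidate is accepted twice. Between
acceptances the method is plain Douglas-Rachford, which either is interrupted by another acceptance
or reaches the right active set. A return at any other set is correct too, because a feasible
candidate satisfies the KKT conditions and their solution is unique. -/

section Forms

/-! ### Quadratic forms and solvability of linear systems. -/

variable {n : ℕ}

/-- A positive continuous quadratic form dominates every continuous quadratic form. -/
lemma exists_pos_mul_le_of_homogeneous {F G : (Fin n → ℝ) → ℝ} (hF : Continuous F)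
    (hG : Continuous G) (hF2 : ∀ (t : ℝ) x, F (t • x) = t ^ 2 * F x)
    (hG2 : ∀ (t : ℝ) x, G (t • x) = t ^ 2 * G x) (hpos : ∀ x ≠ 0, 0 < F x) :
    ∃ c : ℝ, 0 < c ∧ c ≤ 1 / 2 ∧ ∀ x, c * G x ≤ F x := by
  have hF0 : F 0 = 0 := by simpa using hF2 0 0
  have hG0 : G 0 = 0 := by simpa using hG2 0 0
  -- The unit sphere is empty when `n = 0`. Otherwise compactness bounds `F` below and `G` above on
  -- it, and homogeneity does the rest.
  by_cases hn : (Metric.sphere (0 : Fin n → ℝ) 1).Nonempty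
  · obtain ⟨x₀, hx₀, hmin⟩ := (isCompact_sphere (0 : Fin n → ℝ) 1).exists_isMinOn hn hF.continuousOn
    obtain ⟨x₁, -, hmax⟩ := (isCompact_sphere (0 : Fin n → ℝ) 1).exists_isMaxOn hn hG.continuousOn
    have ha : 0 < F x₀ := hpos _ (by rintro rfl; simp at hx₀)
    have hB : 0 < |G x₁| + 1 := by positivity
    -- The cap `1 / 2` keeps `1 - c` nonnegative, so that it can serve as a contraction factor.
    refine ⟨min (1 / 2) (F x₀ / (|G x₁| + 1)), by positivity, min_le_left _ _, fun x => ?_⟩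
    set c := min (1 / 2) (F x₀ / (|G x₁| + 1)) with hc
    have hc0 : 0 < c := by positivity
    have hc1 : c * (|G x₁| + 1) ≤ F x₀ := by
      rw [← le_div_iff₀ hB]; exact min_le_right _ _
    by_cases hx : x = 0
    · simp [hx, hF0, hG0]
    have hx' : ‖x‖ ≠ 0 := by simpa using hx
    have hu : ‖x‖⁻¹ • x ∈ Metric.sphere (0 : Fin n → ℝ) 1 := by
      simp [norm_smul, hx']
    have hxu : x = ‖x‖ • (‖x‖⁻¹ • x) := by simp [smul_smul, hx']
    generalize ‖x‖⁻¹ • x = v at hu hxu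
    have h1 : F x₀ ≤ F v := hmin hu
    have h2 : G v ≤ G x₁ := hmax hu
    have h3 : c * G v ≤ F v := by
      have := mul_le_mul_of_nonneg_left (h2.trans (le_abs_self _)) hc0.le
      linarith
    rw [hxu, hF2, hG2]
    have := mul_le_mul_of_nonneg_left h3 (sq_nonneg ‖x‖)
    linarith
  · refine ⟨1 / 2, by norm_num, le_rfl, fun x => ?_⟩
    have hx : x = 0 := by
      by_contra hx
      exact hn ⟨‖x‖⁻¹ • x, by simp [norm_smul, hx]⟩
    simp [hx, hF0, hG0]

/-- A matrix with positive quadratic form is invertible. -/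
lemma Matrix.isUnit_det_of_dotProduct_pos {M : Matrix (Fin n) (Fin n) ℝ}
    (hM : ∀ x ≠ 0, 0 < x ⬝ᵥ (M *ᵥ x)) : IsUnit M.det := by
  rw [isUnit_iff_ne_zero]
  intro h
  obtain ⟨v, hv, hMv⟩ := Matrix.exists_mulVec_eq_zero_iff.2 h
  simpa [hMv] using hM v hv

lemma abs_dotProduct_le_mul_norm (a x : Fin n → ℝ) : |a ⬝ᵥ x| ≤ (∑ i, |a i|) * ‖x‖ := by
  rw [dotProduct, Finset.sum_mul]
  refine (Finset.abs_sum_le_sum_abs _ _).trans (Finset.sum_le_sum fun i _ => ?_)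
  rw [abs_mul]
  exact mul_le_mul_of_nonneg_left (norm_le_pi_norm x i) (abs_nonneg _)

lemma dotProduct_self_real_nonneg (x : Fin n → ℝ) : 0 ≤ x ⬝ᵥ x :=
  Finset.sum_nonneg fun i _ => mul_self_nonneg (x i)

/-- The Fredholm alternative for matrices. -/
lemma Matrix.exists_mulVec_eq {ι κ : Type*} [Fintype ι] [Fintype κ] [DecidableEq ι]
    (M : Matrix ι κ ℝ) (r : ι → ℝ) (h : ∀ v, v ᵥ* M = 0 → v ⬝ᵥ r = 0) :
    ∃ x, M *ᵥ x = r := by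
  by_contra hr
  have hr' : r ∉ LinearMap.range M.mulVecLin := by
    rintro ⟨x, hx⟩; exact hr ⟨x, by simpa using hx⟩
  -- A functional that vanishes on the range but not at `r`; its coordinate vector is a left null
  -- vector of `M` not orthogonal to `r`.
  obtain ⟨φ, hφr, hφ⟩ := Submodule.exists_le_ker_of_notMem hr'
  have hφv : ∀ x, φ x = (fun i => φ (Pi.single i 1)) ⬝ᵥ x := by
    intro x
    rw [LinearMap.pi_apply_eq_sum_univ φ x, dotProduct]
    refine Finset.sum_congr rfl fun i _ => ?_
    rw [smul_eq_mul, mul_comm]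
    congr 2
    ext j
    simp [Pi.single_apply, eq_comm]
  refine hφr ?_
  rw [hφv]
  apply h
  refine dotProduct_eq_zero _ fun w => ?_
  rw [← Matrix.dotProduct_mulVec, ← hφv]
  exact hφ ⟨w, rfl⟩

/-- A family of linearly independent rows has a dual family. -/
lemma Matrix.exists_mulVec_eq_of_linearIndependent_row {ι κ : Type*} [Fintype ι] [Fintype κ]
    [DecidableEq ι] {M : Matrix ι κ ℝ} (h : LinearIndependent ℝ M.row) (r : ι → ℝ) :
    ∃ x, M *ᵥ x = r := by
  refine M.exists_mulVec_eq r fun v hv => ?_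
  have : v = 0 := Matrix.vecMul_injective_iff.2 h (by simpa using hv)
  simp [this]

end Forms

namespace AVI

/-! ### The quadratic program and its variational inequality. -/

variable {n m : ℕ} {P : AVI n m} {ρ : ℝ}

lemma dotProduct_H_pos (hH : (P.H + P.Hᵀ).PosDef) {x : Fin n → ℝ} (hx : x ≠ 0) :
    0 < x ⬝ᵥ (P.H *ᵥ x) := by
  have h := hH.dotProduct_mulVec_pos hx
  have h2 : x ⬝ᵥ (P.Hᵀ *ᵥ x) = x ⬝ᵥ (P.H *ᵥ x) := by
    rw [Matrix.mulVec_transpose, dotProduct_comm, Matrix.dotProduct_mulVec]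
  simp only [star_trivial, Matrix.add_mulVec, dotProduct_add, h2] at h
  linarith

lemma dotProduct_H_nonneg (hH : (P.H + P.Hᵀ).PosDef) (x : Fin n → ℝ) :
    0 ≤ x ⬝ᵥ (P.H *ᵥ x) := by
  by_cases hx : x = 0
  · simp [hx]
  · exact (dotProduct_H_pos hH hx).le

lemma eq_zero_of_dotProduct_H_nonpos (hH : (P.H + P.Hᵀ).PosDef) {x : Fin n → ℝ}
    (hx : x ⬝ᵥ (P.H *ᵥ x) ≤ 0) : x = 0 := by
  by_contra h
  exact (dotProduct_H_pos hH h).not_ge hx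

lemma dotProduct_Hs (x : Fin n → ℝ) : x ⬝ᵥ (P.Hs *ᵥ x) = x ⬝ᵥ (P.H *ᵥ x) := by
  have h2 : x ⬝ᵥ (P.Hᵀ *ᵥ x) = x ⬝ᵥ (P.H *ᵥ x) := by
    rw [Matrix.mulVec_transpose, dotProduct_comm, Matrix.dotProduct_mulVec]
  simp only [Hs, Matrix.smul_mulVec, Matrix.add_mulVec, dotProduct_smul, dotProduct_add, h2,
    smul_eq_mul]
  ring

lemma transpose_Hs : P.Hsᵀ = P.Hs := by
  simp [Hs, add_comm]

lemma dotProduct_Ht (x : Fin n → ℝ) :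
    x ⬝ᵥ (P.Ht ρ *ᵥ x) = ρ * (x ⬝ᵥ x) + x ⬝ᵥ (P.H *ᵥ x) := by
  simp [Ht, Matrix.add_mulVec, Matrix.smul_mulVec, dotProduct_Hs]

lemma dotProduct_Ht_comm (x y : Fin n → ℝ) : x ⬝ᵥ (P.Ht ρ *ᵥ y) = y ⬝ᵥ (P.Ht ρ *ᵥ x) := by
  have h : (P.Ht ρ)ᵀ = P.Ht ρ := by simp [Ht, transpose_Hs]
  rw [Matrix.dotProduct_mulVec, dotProduct_comm, ← Matrix.mulVec_transpose, h]

lemma dotProduct_Ht_pos (hρ : 0 < ρ) (hH : (P.H + P.Hᵀ).PosDef) {x : Fin n → ℝ} (hx : x ≠ 0) :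
    0 < x ⬝ᵥ (P.Ht ρ *ᵥ x) := by
  rw [dotProduct_Ht]
  have := dotProduct_H_pos hH hx
  have : 0 ≤ x ⬝ᵥ x := dotProduct_self_real_nonneg x
  positivity

lemma convex_feasible : Convex ℝ P.feasible := by
  intro x hx y hy a b ha hb hab i
  have h1 := mul_le_mul_of_nonneg_left (hx i) ha
  have h2 := mul_le_mul_of_nonneg_left (hy i) hb
  have h3 : P.b i = a * P.b i + b * P.b i := by rw [← add_mul, hab, one_mul]
  simp only [Matrix.mulVec_add, Matrix.mulVec_smul, Pi.add_apply, Pi.smul_apply, smul_eq_mul]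
  linarith

lemma isClosed_feasible : IsClosed P.feasible :=
  isClosed_le (by fun_prop) continuous_const

/-- The variational inequality that characterizes the solution of the quadratic program. -/
def IsQPStationary (P : AVI n m) (ρ : ℝ) (z y : Fin n → ℝ) : Prop :=
  y ∈ P.feasible ∧ ∀ x ∈ P.feasible, 0 ≤ (P.Ht ρ *ᵥ y + P.ft ρ z) ⬝ᵥ (x - y)

lemma IsQPSolution.isQPStationary (hρ : 0 < ρ) (hH : (P.H + P.Hᵀ).PosDef) {z y : Fin n → ℝ}
    (h : P.IsQPSolution ρ z y) : P.IsQPStationary ρ z y := by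
  refine ⟨h.1, fun x hx => ?_⟩
  set d := x - y with hd
  set q := d ⬝ᵥ (P.Ht ρ *ᵥ d) with hq
  set g := (P.Ht ρ *ᵥ y + P.ft ρ z) ⬝ᵥ d with hg
  have key : ∀ t : ℝ, 0 < t → t ≤ 1 → 0 ≤ g + t * (q / 2) := by
    intro t ht ht1
    have hmem : y + t • d ∈ P.feasible :=
      convex_feasible.add_smul_sub_mem h.1 hx ⟨ht.le, ht1⟩
    have hle : P.qpObj ρ z y ≤ P.qpObj ρ z (y + t • d) := h.2 hmem
    have hexp : P.qpObj ρ z (y + t • d) = P.qpObj ρ z y + t * (g + t * (q / 2)) := by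
      simp only [qpObj, hg, hq, Matrix.mulVec_add, Matrix.mulVec_smul, dotProduct_add,
        add_dotProduct, dotProduct_smul, smul_dotProduct, smul_eq_mul, dotProduct_Ht_comm y d]
      rw [dotProduct_comm (P.Ht ρ *ᵥ y) d]
      ring
    by_contra hneg
    have := mul_neg_of_pos_of_neg ht (not_le.1 hneg)
    linarith
  by_contra hneg
  have hneg : g < 0 := not_le.1 hneg
  -- If `g < 0`, the step `t = min 1 (-g / (q + 1))` satisfies `t * q < -g`, so that `g + t * (q /
  -- 2) < g / 2 < 0`, against `key`.
  have hq0 : 0 ≤ q := by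
    by_cases hd0 : d = 0
    · simp [hq, hd0]
    · exact (dotProduct_Ht_pos hρ hH hd0).le
  have h1 := key (min 1 (-g / (q + 1))) (by have : 0 < -g := by linarith
                                            positivity) (min_le_left _ _)
  have h2 : min 1 (-g / (q + 1)) * (q + 1) ≤ -g := by
    rw [← le_div_iff₀ (by positivity)]; exact min_le_right _ _
  have h3 : 0 < min 1 (-g / (q + 1)) := by
    have : 0 < -g := by linarith
    positivity
  nlinarith

lemma ft_sub (z₁ z₂ : Fin n → ℝ) : P.ft ρ z₁ - P.ft ρ z₂ = (P.H - P.Ht ρ) *ᵥ (z₁ - z₂) := by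
  simp [ft, Matrix.mulVec_sub]

/-- Each variational inequality is tested at the other solution and the two are added. -/
lemma IsQPStationary.monotone {z₁ y₁ z₂ y₂ : Fin n → ℝ} (h₁ : P.IsQPStationary ρ z₁ y₁)
    (h₂ : P.IsQPStationary ρ z₂ y₂) :
    (y₁ - y₂) ⬝ᵥ (P.Ht ρ *ᵥ (y₁ - y₂) + (P.H - P.Ht ρ) *ᵥ (z₁ - z₂)) ≤ 0 := by
  have a := h₁.2 y₂ h₂.1
  have b := h₂.2 y₁ h₁.1
  rw [← ft_sub, dotProduct_comm]
  simp only [Matrix.mulVec_sub, add_dotProduct, sub_dotProduct, dotProduct_sub] at a b ⊢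
  linarith

lemma IsQPStationary.unique (hρ : 0 < ρ) (hH : (P.H + P.Hᵀ).PosDef) {z y₁ y₂ : Fin n → ℝ}
    (h₁ : P.IsQPStationary ρ z y₁) (h₂ : P.IsQPStationary ρ z y₂) : y₁ = y₂ := by
  have h := h₁.monotone h₂
  rw [sub_self, Matrix.mulVec_zero, add_zero] at h
  by_contra hne
  exact (dotProduct_Ht_pos hρ hH (sub_ne_zero.2 hne)).not_ge h

lemma exists_isQPSolution (hρ : 0 < ρ) (hX : P.feasible.Nonempty) (hH : (P.H + P.Hᵀ).PosDef)
    (z : Fin n → ℝ) : ∃ y, P.IsQPSolution ρ z y := by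
  obtain ⟨x₀, hx₀⟩ := hX
  have hcont : Continuous (P.qpObj ρ z) := by unfold qpObj; fun_prop
  obtain ⟨c, hc0, -, hc⟩ := exists_pos_mul_le_of_homogeneous
    (F := fun x : Fin n → ℝ => x ⬝ᵥ (P.Ht ρ *ᵥ x)) (G := fun x => ‖x‖ ^ 2)
    (by fun_prop) (by fun_prop)
    (fun t x => by simp only [Matrix.mulVec_smul, dotProduct_smul, smul_dotProduct, smul_eq_mul]
                   ring)
    (fun t x => by simp [norm_smul, mul_pow])
    (fun x hx => dotProduct_Ht_pos hρ hH hx)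
  set K := ∑ i, |P.ft ρ z i|
  -- Coercivity: the quadratic part dominates the square of the sup norm, the linear part is at most
  -- `K` times the norm.
  have hlow : ∀ x, ‖x‖ * (c / 2 * ‖x‖ - K) ≤ P.qpObj ρ z x := by
    intro x
    have h1 := hc x
    have h2 := neg_le_of_abs_le (abs_dotProduct_le_mul_norm (P.ft ρ z) x)
    simp only [qpObj] at h1 ⊢
    nlinarith
  have hlim : Filter.Tendsto (P.qpObj ρ z) (Filter.cocompact _) Filter.atTop := by
    refine Filter.tendsto_atTop_mono hlow ?_
    have hr : Filter.Tendsto (fun r : ℝ => r * (c / 2 * r - K)) Filter.atTop Filter.atTop := by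
      refine Filter.tendsto_id.atTop_mul_atTop₀ ?_
      exact Filter.tendsto_atTop_add_const_right _ _
        (Filter.tendsto_id.const_mul_atTop (by positivity))
    exact hr.comp (tendsto_norm_cocompact_atTop (E := Fin n → ℝ))
  obtain ⟨y, hy, hmin⟩ := hcont.continuousOn.exists_isMinOn' isClosed_feasible hx₀
    ((hlim.eventually_ge_atTop _).filter_mono inf_le_left)
  exact ⟨y, hy, hmin⟩

/-- With parameter `z = x` the gradient of the QP at `x` is the AVI operator, so AVI solutions are
exactly the points that solve their own QP. -/
lemma Ht_mulVec_add_ft (x : Fin n → ℝ) : P.Ht ρ *ᵥ x + P.ft ρ x = P.H *ᵥ x + P.f := by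
  simp only [ft, Matrix.sub_mulVec]
  abel

lemma IsSolution.isQPStationary {x : Fin n → ℝ} (h : P.IsSolution x) :
    P.IsQPStationary ρ x x := by
  refine ⟨h.1, ?_⟩
  rw [Ht_mulVec_add_ft]
  exact h.2

lemma IsQPStationary.isSolution {x : Fin n → ℝ} (h : P.IsQPStationary ρ x x) :
    P.IsSolution x := by
  refine ⟨h.1, ?_⟩
  rw [← Ht_mulVec_add_ft (ρ := ρ)]
  exact h.2

lemma IsSolution.unique (hH : (P.H + P.Hᵀ).PosDef) {x y : Fin n → ℝ} (hx : P.IsSolution x)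
    (hy : P.IsSolution y) : x = y := by
  have a := hx.2 y hy.1
  have b := hy.2 x hx.1
  refine sub_eq_zero.1 (eq_zero_of_dotProduct_H_nonpos hH ?_)
  rw [dotProduct_comm]
  simp only [Matrix.mulVec_sub, add_dotProduct, sub_dotProduct, dotProduct_sub] at a b ⊢
  linarith

/-! ### The contraction estimate. -/

/-- The matrix `ρ I + H_s / 2` of the inner product in which the Douglas-Rachford iteration
contracts. -/
noncomputable def drMetric (P : AVI n m) (ρ : ℝ) : Matrix (Fin n) (Fin n) ℝ :=
  ρ • 1 + (1 / 2 : ℝ) • P.Hs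

/-- The squared norm of `(ρ I + H) v` in the metric dual to `drMetric`. -/
noncomputable def lyapunov (P : AVI n m) (ρ : ℝ) (v : Fin n → ℝ) : ℝ :=
  ((P.drMetric ρ)⁻¹ *ᵥ ((ρ • 1 + P.H) *ᵥ v)) ⬝ᵥ ((ρ • 1 + P.H) *ᵥ v)

lemma dotProduct_drMetric (x : Fin n → ℝ) :
    x ⬝ᵥ (P.drMetric ρ *ᵥ x) = ρ * (x ⬝ᵥ x) + (x ⬝ᵥ (P.H *ᵥ x)) / 2 := by
  simp only [drMetric, Matrix.add_mulVec, Matrix.smul_mulVec, dotProduct_add, dotProduct_smul,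
    dotProduct_Hs, Matrix.one_mulVec, smul_eq_mul]
  ring

lemma dotProduct_drMetric_comm (x y : Fin n → ℝ) :
    x ⬝ᵥ (P.drMetric ρ *ᵥ y) = y ⬝ᵥ (P.drMetric ρ *ᵥ x) := by
  have h : (P.drMetric ρ)ᵀ = P.drMetric ρ := by simp [drMetric, transpose_Hs]
  rw [Matrix.dotProduct_mulVec, dotProduct_comm, ← Matrix.mulVec_transpose, h]

lemma dotProduct_drMetric_pos (hρ : 0 < ρ) (hH : (P.H + P.Hᵀ).PosDef) {x : Fin n → ℝ}
    (hx : x ≠ 0) : 0 < x ⬝ᵥ (P.drMetric ρ *ᵥ x) := by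
  rw [dotProduct_drMetric]
  have := dotProduct_H_pos hH hx
  have := dotProduct_self_real_nonneg x
  positivity

lemma isUnit_det_drMetric (hρ : 0 < ρ) (hH : (P.H + P.Hᵀ).PosDef) :
    IsUnit (P.drMetric ρ).det :=
  Matrix.isUnit_det_of_dotProduct_pos fun _ => dotProduct_drMetric_pos hρ hH

lemma isUnit_det_smul_one_add_H (hρ : 0 < ρ) (hH : (P.H + P.Hᵀ).PosDef) :
    IsUnit (ρ • (1 : Matrix (Fin n) (Fin n) ℝ) + P.H).det :=
  Matrix.isUnit_det_of_dotProduct_pos fun x hx => by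
    have := dotProduct_H_pos hH hx
    have := dotProduct_self_real_nonneg x
    simp only [Matrix.add_mulVec, Matrix.smul_mulVec, Matrix.one_mulVec, dotProduct_add,
      dotProduct_smul, smul_eq_mul]
    positivity

lemma drMetric_mulVec_inv (hρ : 0 < ρ) (hH : (P.H + P.Hᵀ).PosDef) (v : Fin n → ℝ) :
    P.drMetric ρ *ᵥ ((P.drMetric ρ)⁻¹ *ᵥ v) = v := by
  rw [Matrix.mulVec_mulVec, Matrix.mul_nonsing_inv _ (isUnit_det_drMetric hρ hH),
    Matrix.one_mulVec]

lemma inv_mulVec_drMetric (hρ : 0 < ρ) (hH : (P.H + P.Hᵀ).PosDef) (v : Fin n → ℝ) :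
    (P.drMetric ρ)⁻¹ *ᵥ (P.drMetric ρ *ᵥ v) = v := by
  rw [Matrix.mulVec_mulVec, Matrix.nonsing_inv_mul _ (isUnit_det_drMetric hρ hH),
    Matrix.one_mulVec]

lemma mulVec_drUpdate (hρ : 0 < ρ) (hH : (P.H + P.Hᵀ).PosDef) (z y : Fin n → ℝ) :
    (ρ • 1 + P.H) *ᵥ P.drUpdate ρ z y = (ρ • 1 + P.H) *ᵥ z + P.drMetric ρ *ᵥ (y - z) := by
  rw [drUpdate, Matrix.mulVec_mulVec,
    Matrix.mul_nonsing_inv _ (isUnit_det_smul_one_add_H hρ hH), Matrix.one_mulVec]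
  simp only [drMetric, Matrix.add_mulVec, Matrix.smul_mulVec, Matrix.one_mulVec, smul_sub]
  abel

lemma eq_of_drUpdate_eq (hρ : 0 < ρ) (hH : (P.H + P.Hᵀ).PosDef) {z y : Fin n → ℝ}
    (h : P.drUpdate ρ z y = z) : y = z := by
  have h1 := mulVec_drUpdate hρ hH z y
  rw [h, left_eq_add] at h1
  have h2 := inv_mulVec_drMetric hρ hH (y - z)
  rw [h1, Matrix.mulVec_zero] at h2
  exact sub_eq_zero.1 h2.symm

lemma drUpdate_self (hρ : 0 < ρ) (hH : (P.H + P.Hᵀ).PosDef) (z : Fin n → ℝ) :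
    P.drUpdate ρ z z = z := by
  have h := mulVec_drUpdate hρ hH z z
  rw [sub_self, Matrix.mulVec_zero, add_zero] at h
  exact Matrix.mulVec_injective_of_isUnit
    ((Matrix.isUnit_iff_isUnit_det _).2 (isUnit_det_smul_one_add_H hρ hH)) h

lemma lyapunov_eq (hρ : 0 < ρ) (hH : (P.H + P.Hᵀ).PosDef) {v w : Fin n → ℝ}
    (h : (ρ • 1 + P.H) *ᵥ v = P.drMetric ρ *ᵥ w) :
    P.lyapunov ρ v = w ⬝ᵥ (P.drMetric ρ *ᵥ w) := by
  rw [lyapunov, h, inv_mulVec_drMetric hρ hH]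

lemma lyapunov_pos (hρ : 0 < ρ) (hH : (P.H + P.Hᵀ).PosDef) {v : Fin n → ℝ} (hv : v ≠ 0) :
    0 < P.lyapunov ρ v := by
  have h := drMetric_mulVec_inv hρ hH ((ρ • 1 + P.H) *ᵥ v)
  rw [lyapunov_eq hρ hH h.symm]
  refine dotProduct_drMetric_pos hρ hH fun h0 => hv ?_
  rw [h0, Matrix.mulVec_zero] at h
  refine Matrix.mulVec_injective_of_isUnit
    ((Matrix.isUnit_iff_isUnit_det _).2 (isUnit_det_smul_one_add_H hρ hH)) ?_
  rw [← h, Matrix.mulVec_zero]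

lemma lyapunov_nonneg (hρ : 0 < ρ) (hH : (P.H + P.Hᵀ).PosDef) (v : Fin n → ℝ) :
    0 ≤ P.lyapunov ρ v := by
  by_cases hv : v = 0
  · simp [hv, lyapunov]
  · exact (lyapunov_pos hρ hH hv).le

lemma continuous_lyapunov : Continuous (P.lyapunov ρ) := by
  unfold lyapunov; fun_prop

lemma lyapunov_smul (t : ℝ) (v : Fin n → ℝ) :
    P.lyapunov ρ (t • v) = t ^ 2 * P.lyapunov ρ v := by
  simp only [lyapunov, Matrix.mulVec_smul, dotProduct_smul, smul_dotProduct, smul_eq_mul]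
  ring

/-- In the norm of `drMetric`, with `e`, `d` the differences of the `z` and the `y`, the old and new
values of `lyapunov` are the squares of `e + u` and `d + u` for one common `u`. Monotonicity of the
QP bounds the term in `d` and `u`. What the decrease has beyond the two `H`-forms is the square of
`e - d`. -/
lemma lyapunov_drUpdate_add_le (hρ : 0 < ρ) (hH : (P.H + P.Hᵀ).PosDef)
    {z₁ y₁ z₂ y₂ : Fin n → ℝ} (h₁ : P.IsQPStationary ρ z₁ y₁) (h₂ : P.IsQPStationary ρ z₂ y₂) :
    P.lyapunov ρ (P.drUpdate ρ z₁ y₁ - P.drUpdate ρ z₂ y₂) +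
      (z₁ - z₂) ⬝ᵥ (P.H *ᵥ (z₁ - z₂)) + (y₁ - y₂) ⬝ᵥ (P.H *ᵥ (y₁ - y₂)) ≤
    P.lyapunov ρ (z₁ - z₂) := by
  have hmono := h₁.monotone h₂
  have hupd : (ρ • 1 + P.H) *ᵥ (P.drUpdate ρ z₁ y₁ - P.drUpdate ρ z₂ y₂) =
      (ρ • 1 + P.H) *ᵥ (z₁ - z₂) + P.drMetric ρ *ᵥ ((y₁ - y₂) - (z₁ - z₂)) := by
    simp only [Matrix.mulVec_sub, mulVec_drUpdate hρ hH]
    abel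
  generalize P.drUpdate ρ z₁ y₁ - P.drUpdate ρ z₂ y₂ = e' at hupd ⊢
  generalize z₁ - z₂ = e at hmono hupd ⊢
  generalize y₁ - y₂ = d at hmono hupd ⊢
  obtain ⟨u, hu⟩ : ∃ u, P.drMetric ρ *ᵥ u = (ρ • 1 + P.H) *ᵥ e - P.drMetric ρ *ᵥ e :=
    ⟨_, drMetric_mulVec_inv hρ hH _⟩
  have he : (ρ • 1 + P.H) *ᵥ e = P.drMetric ρ *ᵥ (e + u) := by
    rw [Matrix.mulVec_add, hu]; abel
  have he' : (ρ • 1 + P.H) *ᵥ e' = P.drMetric ρ *ᵥ (d + u) := by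
    rw [hupd, he]; simp only [Matrix.mulVec_add, Matrix.mulVec_sub]; abel
  rw [lyapunov_eq hρ hH he, lyapunov_eq hρ hH he']
  -- The skew part of `H` drops out of the form, and `drMetric` carries only half of `H_s`; the
  -- other half remains.
  have heu : e ⬝ᵥ (P.drMetric ρ *ᵥ u) = (e ⬝ᵥ (P.H *ᵥ e)) / 2 := by
    rw [hu, dotProduct_sub, dotProduct_drMetric]
    simp only [Matrix.add_mulVec, Matrix.smul_mulVec, Matrix.one_mulVec, dotProduct_add,
      dotProduct_smul, smul_eq_mul]
    ring
  have hgrad : P.Ht ρ *ᵥ d + (P.H - P.Ht ρ) *ᵥ e = P.drMetric ρ *ᵥ d + (1 / 2 : ℝ) • P.Hs *ᵥ d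
      + P.drMetric ρ *ᵥ u - P.drMetric ρ *ᵥ e := by
    rw [hu]
    simp only [Ht, drMetric, Matrix.add_mulVec, Matrix.sub_mulVec, Matrix.smul_mulVec,
      Matrix.one_mulVec]
    module
  rw [hgrad] at hmono
  have hsq : 0 ≤ (e - d) ⬝ᵥ (P.drMetric ρ *ᵥ (e - d)) := by
    by_cases h0 : e - d = 0
    · simp [h0]
    · exact (dotProduct_drMetric_pos hρ hH h0).le
  simp only [Matrix.mulVec_add, Matrix.mulVec_sub, dotProduct_add, dotProduct_sub, add_dotProduct,
    sub_dotProduct, dotProduct_smul, smul_eq_mul, dotProduct_Hs] at hmono hsq ⊢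
  rw [dotProduct_drMetric_comm u d, dotProduct_drMetric_comm u e]
  rw [dotProduct_drMetric_comm d e] at hmono hsq
  linarith

/-- The solution of the quadratic program with parameter `z`. -/
noncomputable def qpSol (P : AVI n m) (ρ : ℝ) (z : Fin n → ℝ) : Fin n → ℝ :=
  Classical.epsilon (P.IsQPSolution ρ z)

/-- The plain Douglas-Rachford iteration. -/
noncomputable def drMap (P : AVI n m) (ρ : ℝ) (z : Fin n → ℝ) : Fin n → ℝ :=
  P.drUpdate ρ z (P.qpSol ρ z)

lemma isQPSolution_qpSol (hρ : 0 < ρ) (hX : P.feasible.Nonempty) (hH : (P.H + P.Hᵀ).PosDef)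
    (z : Fin n → ℝ) : P.IsQPSolution ρ z (P.qpSol ρ z) :=
  Classical.epsilon_spec (exists_isQPSolution hρ hX hH z)

lemma isQPStationary_qpSol (hρ : 0 < ρ) (hX : P.feasible.Nonempty) (hH : (P.H + P.Hᵀ).PosDef)
    (z : Fin n → ℝ) : P.IsQPStationary ρ z (P.qpSol ρ z) :=
  (isQPSolution_qpSol hρ hX hH z).isQPStationary hρ hH

lemma IsQPSolution.eq_qpSol (hρ : 0 < ρ) (hX : P.feasible.Nonempty) (hH : (P.H + P.Hᵀ).PosDef)
    {z y : Fin n → ℝ} (h : P.IsQPSolution ρ z y) : y = P.qpSol ρ z :=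
  (h.isQPStationary hρ hH).unique hρ hH (isQPStationary_qpSol hρ hX hH z)

lemma exists_lyapunov_iterate_le (hρ : 0 < ρ) (hX : P.feasible.Nonempty)
    (hH : (P.H + P.Hᵀ).PosDef) :
    ∃ q : ℝ, 0 ≤ q ∧ q < 1 ∧ ∀ k z₁ z₂,
      P.lyapunov ρ ((P.drMap ρ)^[k] z₁ - (P.drMap ρ)^[k] z₂) ≤ q ^ k * P.lyapunov ρ (z₁ - z₂) := by
  obtain ⟨c, hc0, hc1, hc⟩ := exists_pos_mul_le_of_homogeneous
    (F := fun x : Fin n → ℝ => x ⬝ᵥ (P.H *ᵥ x)) (G := P.lyapunov ρ)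
    (by fun_prop) continuous_lyapunov
    (fun t x => by simp only [Matrix.mulVec_smul, dotProduct_smul, smul_dotProduct, smul_eq_mul]
                   ring)
    lyapunov_smul (fun x hx => dotProduct_H_pos hH hx)
  -- By the choice of `c`, the loss from the `z`-difference alone is at least `c` times `lyapunov`.
  refine ⟨1 - c, by linarith, by linarith, fun k => ?_⟩
  induction k with
  | zero => simp
  | succ k ih =>
    intro z₁ z₂
    rw [Function.iterate_succ_apply, Function.iterate_succ_apply, pow_succ, mul_assoc]
    refine (ih _ _).trans (mul_le_mul_of_nonneg_left ?_ (pow_nonneg (by linarith) _))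
    have h := lyapunov_drUpdate_add_le hρ hH (isQPStationary_qpSol hρ hX hH z₁)
      (isQPStationary_qpSol hρ hX hH z₂)
    have h1 := hc (z₁ - z₂)
    have h2 := dotProduct_H_nonneg hH (P.qpSol ρ z₁ - P.qpSol ρ z₂)
    simp only [drMap] at h1 ⊢
    linarith

lemma exists_norm_sq_le_lyapunov (hρ : 0 < ρ) (hH : (P.H + P.Hᵀ).PosDef) :
    ∃ c : ℝ, 0 < c ∧ ∀ v, c * ‖v‖ ^ 2 ≤ P.lyapunov ρ v := by
  obtain ⟨c, hc0, -, hc⟩ := exists_pos_mul_le_of_homogeneous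
    (F := P.lyapunov ρ) (G := fun x => ‖x‖ ^ 2) continuous_lyapunov (by fun_prop) lyapunov_smul
    (fun t x => by simp [norm_smul, mul_pow]) (fun x hx => lyapunov_pos hρ hH hx)
  exact ⟨c, hc0, hc⟩

lemma exists_norm_sq_le_dotProduct_H (hH : (P.H + P.Hᵀ).PosDef) :
    ∃ c : ℝ, 0 < c ∧ ∀ v, c * ‖v‖ ^ 2 ≤ v ⬝ᵥ (P.H *ᵥ v) := by
  obtain ⟨c, hc0, -, hc⟩ := exists_pos_mul_le_of_homogeneous
    (F := fun x : Fin n → ℝ => x ⬝ᵥ (P.H *ᵥ x)) (G := fun x => ‖x‖ ^ 2)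
    (by fun_prop) (by fun_prop)
    (fun t x => by simp only [Matrix.mulVec_smul, dotProduct_smul, smul_dotProduct, smul_eq_mul]
                   ring)
    (fun t x => by simp [norm_smul, mul_pow]) (fun x hx => dotProduct_H_pos hH hx)
  exact ⟨c, hc0, hc⟩

/-! ### Existence of a solution and convergence of the plain iteration. -/

open Filter Topology

lemma tendsto_zero_of_norm_sq_le {v : ℕ → Fin n → ℝ} {g : ℕ → ℝ} {c : ℝ} (hc : 0 < c)
    (h : ∀ k, c * ‖v k‖ ^ 2 ≤ g k) (hg : Tendsto g atTop (𝓝 0)) : Tendsto v atTop (𝓝 0) := by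
  rw [tendsto_zero_iff_norm_tendsto_zero]
  have h1 : Tendsto (fun k => √(g k / c)) atTop (𝓝 0) := by
    simpa using (hg.div_const c).sqrt
  refine squeeze_zero (fun _ => norm_nonneg _) (fun k => Real.le_sqrt_of_sq_le ?_) h1
  rw [le_div_iff₀ hc]
  linarith [h k]

/-- The Douglas-Rachford iteration has a fixed point, which solves the variational inequality. -/
lemma exists_isSolution (hX : P.feasible.Nonempty) (hH : (P.H + P.Hᵀ).PosDef) :
    ∃ x, P.IsSolution x := by
  -- The claim does not involve `ρ`, so any positive value will do.
  have hρ : (0 : ℝ) < 1 := one_pos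
  obtain ⟨q, hq0, hq1, hq⟩ := exists_lyapunov_iterate_le hρ hX hH
  obtain ⟨c, hc0, hc⟩ := exists_norm_sq_le_lyapunov hρ hH
  set T := P.drMap 1
  set L := P.lyapunov 1 (T 0 - 0)
  have hL : 0 ≤ L := lyapunov_nonneg hρ hH _
  -- Since `lyapunov` is a squared norm, distances decay with the ratio `√q`.
  have hstep : ∀ k, dist (T^[k] 0) (T^[k + 1] 0) ≤ √(L / c) * √q ^ k := by
    intro k
    rw [dist_comm, dist_eq_norm, Function.iterate_succ_apply]
    have h1 : ‖T^[k] (T 0) - T^[k] 0‖ ^ 2 ≤ (√(L / c) * √q ^ k) ^ 2 := by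
      rw [mul_pow, Real.sq_sqrt (by positivity), ← pow_mul, mul_comm k, pow_mul,
        Real.sq_sqrt hq0, div_mul_eq_mul_div, le_div_iff₀ hc0]
      linarith [hc (T^[k] (T 0) - T^[k] 0), hq k (T 0) 0]
    exact le_of_sq_le_sq h1 (by positivity)
  have hsq : √q < 1 := by rw [Real.sqrt_lt' one_pos]; simpa
  obtain ⟨x, hx⟩ := cauchySeq_tendsto_of_complete (cauchySeq_of_le_geometric _ _ hsq hstep)
  have hTx : Tendsto (fun k => T (T^[k] 0)) atTop (𝓝 (T x)) := by
    rw [← tendsto_sub_nhds_zero_iff]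
    have h0 : Tendsto (fun k => P.lyapunov 1 (T^[k] 0 - x)) atTop (𝓝 0) := by
      have := (continuous_lyapunov (P := P) (ρ := 1)).tendsto 0
      rw [show P.lyapunov 1 0 = 0 by simp [lyapunov]] at this
      exact this.comp (tendsto_sub_nhds_zero_iff.2 hx)
    refine tendsto_zero_of_norm_sq_le hc0 (g := fun k => P.lyapunov 1 (T^[k] 0 - x))
      (fun k => (hc _).trans ?_) h0
    have h1 := hq 1 (T^[k] 0) x
    have h2 := lyapunov_nonneg hρ hH (T^[k] 0 - x)
    simp only [Function.iterate_one, pow_one] at h1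
    nlinarith
  have hfix : T x = x := by
    refine tendsto_nhds_unique hTx ?_
    simp_rw [← Function.iterate_succ_apply' T]
    exact hx.comp (tendsto_add_atTop_nat 1)
  have hy := isQPStationary_qpSol hρ hX hH x
  rw [eq_of_drUpdate_eq hρ hH hfix] at hy
  exact ⟨x, hy.isSolution⟩

lemma IsSolution.qpSol_eq (hρ : 0 < ρ) (hX : P.feasible.Nonempty) (hH : (P.H + P.Hᵀ).PosDef)
    {x : Fin n → ℝ} (hx : P.IsSolution x) : P.qpSol ρ x = x :=
  (isQPStationary_qpSol hρ hX hH x).unique hρ hH hx.isQPStationary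

lemma IsSolution.tendsto_iterate (hρ : 0 < ρ) (hX : P.feasible.Nonempty)
    (hH : (P.H + P.Hᵀ).PosDef) {x : Fin n → ℝ} (hx : P.IsSolution x) (z : Fin n → ℝ) :
    Tendsto (fun k => (P.drMap ρ)^[k] z) atTop (𝓝 x) ∧
      Tendsto (fun k => P.qpSol ρ ((P.drMap ρ)^[k] z)) atTop (𝓝 x) := by
  obtain ⟨q, hq0, hq1, hq⟩ := exists_lyapunov_iterate_le hρ hX hH
  obtain ⟨c, hc0, hc⟩ := exists_norm_sq_le_lyapunov hρ hH
  obtain ⟨c', hc0', hc'⟩ := exists_norm_sq_le_dotProduct_H hH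
  have hfix : Function.IsFixedPt (P.drMap ρ) x := by
    rw [Function.IsFixedPt, drMap, hx.qpSol_eq hρ hX hH, drUpdate_self hρ hH]
  have hle : ∀ k, P.lyapunov ρ ((P.drMap ρ)^[k] z - x) ≤ q ^ k * P.lyapunov ρ (z - x) := by
    intro k
    have := hq k z x
    rwa [(hfix.iterate k).eq] at this
  have hlim : Tendsto (fun k => q ^ k * P.lyapunov ρ (z - x)) atTop (𝓝 0) := by
    simpa using (tendsto_pow_atTop_nhds_zero_of_lt_one hq0 hq1).mul_const (P.lyapunov ρ (z - x))
  constructor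
  · rw [← tendsto_sub_nhds_zero_iff]
    exact tendsto_zero_of_norm_sq_le hc0 (fun k => (hc _).trans (hle k)) hlim
  -- For the QP solutions the estimate is used differently: `lyapunov` of the `z`-difference bounds
  -- the `H`-form of the `y`-difference.
  · rw [← tendsto_sub_nhds_zero_iff]
    refine tendsto_zero_of_norm_sq_le hc0' (fun k => (hc' _).trans (le_trans ?_ (hle k))) hlim
    have h := lyapunov_drUpdate_add_le hρ hH
      (isQPStationary_qpSol hρ hX hH ((P.drMap ρ)^[k] z)) (hx.isQPStationary (ρ := ρ))
    have h1 := lyapunov_nonneg hρ hH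
      (P.drUpdate ρ ((P.drMap ρ)^[k] z) (P.qpSol ρ ((P.drMap ρ)^[k] z)) - P.drUpdate ρ x x)
    have h2 := dotProduct_H_nonneg hH ((P.drMap ρ)^[k] z - x)
    linarith

/-! ### Active sets, feasible directions and KKT pairs. -/

lemma mem_activeSet {x : Fin n → ℝ} {i : Fin m} :
    i ∈ P.activeSet x ↔ (P.A *ᵥ x) i = P.b i := by
  simp [activeSet]

lemma rows_mulVec_apply (S : Finset (Fin m)) (x : Fin n → ℝ) (i : S) :
    (P.rows S *ᵥ x) i = (P.A *ᵥ x) i := rfl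

lemma transpose_rows_mulVec (S : Finset (Fin m)) (μ : S → ℝ) :
    (P.rows S)ᵀ *ᵥ μ = P.Aᵀ *ᵥ extendZero S μ := by
  ext j
  simp only [Matrix.mulVec, dotProduct, Matrix.transpose_apply, rows, Matrix.submatrix_apply, id,
    extendZero]
  rw [← Finset.sum_subset (Finset.subset_univ S) (fun i _ hi => by simp [hi]),
    ← Finset.sum_coe_sort S]
  exact Finset.sum_congr rfl fun i _ => by simp

lemma extendZero_restrict {S : Finset (Fin m)} {l : Fin m → ℝ} (h : ∀ i ∉ S, l i = 0) :
    extendZero S (fun i : S => l i) = l := by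
  ext i
  by_cases hi : i ∈ S
  · simp [extendZero, hi]
  · simp [extendZero, hi, h i hi]

/-- A direction that does not increase the active constraints can be followed for a while. -/
lemma exists_add_smul_mem_feasible {x d : Fin n → ℝ} (hx : x ∈ P.feasible)
    (hd : ∀ i ∈ P.activeSet x, (P.A *ᵥ d) i ≤ 0) :
    ∃ ε : ℝ, 0 < ε ∧ x + ε • d ∈ P.feasible := by
  have h : ∀ i, ∀ᶠ ε : ℝ in 𝓝[>] 0, (P.A *ᵥ x) i + ε * (P.A *ᵥ d) i ≤ P.b i := by
    intro i
    by_cases hi : i ∈ P.activeSet x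
    · filter_upwards [self_mem_nhdsWithin] with ε hε
      have := mul_nonneg (le_of_lt (Set.mem_Ioi.1 hε)) (neg_nonneg.2 (hd i hi))
      rw [mem_activeSet] at hi
      linarith
    · have hlt : (P.A *ᵥ x) i < P.b i := lt_of_le_of_ne (hx i) (fun h => hi (mem_activeSet.2 h))
      have hlim : Tendsto (fun ε : ℝ => (P.A *ᵥ x) i + ε * (P.A *ᵥ d) i) (𝓝[>] 0)
          (𝓝 ((P.A *ᵥ x) i + 0 * (P.A *ᵥ d) i)) :=
        ((continuous_const.add (continuous_id.mul continuous_const)).tendsto 0).mono_left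
          nhdsWithin_le_nhds
      rw [zero_mul, add_zero] at hlim
      exact (hlim.eventually_lt_const hlt).mono fun _ => le_of_lt
  obtain ⟨ε, hε, hpos⟩ := ((eventually_all.2 h).and self_mem_nhdsWithin).exists
  refine ⟨ε, hpos, fun i => ?_⟩
  simpa [Matrix.mulVec_add, Matrix.mulVec_smul] using hε i

lemma dotProduct_nonneg_of_direction {x g d : Fin n → ℝ} (hx : x ∈ P.feasible)
    (hg : ∀ y ∈ P.feasible, 0 ≤ g ⬝ᵥ (y - x)) (hd : ∀ i ∈ P.activeSet x, (P.A *ᵥ d) i ≤ 0) :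
    0 ≤ g ⬝ᵥ d := by
  obtain ⟨ε, hε, hmem⟩ := exists_add_smul_mem_feasible hx hd
  have h := hg _ hmem
  rw [add_sub_cancel_left, dotProduct_smul, smul_eq_mul] at h
  exact nonneg_of_mul_nonneg_right h hε

/-- Stationarity turns the product with `y - x` into the multiplier times the slack at `y`, minus
the same at `x`, which is zero. -/
lemma IsKKT.isSolution {x : Fin n → ℝ} {l : Fin m → ℝ} (h : P.IsKKT x l) : P.IsSolution x := by
  obtain ⟨h1, h2, h3, h4⟩ := h
  refine ⟨fun i => by simpa using h3 i, fun y hy => ?_⟩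
  have hy' : 0 ≤ l ⬝ᵥ (P.b - P.A *ᵥ y) :=
    dotProduct_nonneg_of_nonneg h2 (fun i => by simpa using hy i)
  rw [eq_neg_of_add_eq_zero_left h1, neg_dotProduct, Matrix.mulVec_transpose,
    ← Matrix.dotProduct_mulVec, Matrix.mulVec_sub]
  simp only [dotProduct_sub] at h4 hy' ⊢
  linarith

lemma IsKKT.eq_zero_of_notMem {x : Fin n → ℝ} {l : Fin m → ℝ} (h : P.IsKKT x l) {i : Fin m}
    (hi : i ∉ P.activeSet x) : l i = 0 := by
  obtain ⟨-, h2, h3, h4⟩ := h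
  have := (Finset.sum_eq_zero_iff_of_nonneg fun j _ => mul_nonneg (h2 j) (h3 j)).1 h4 i
    (Finset.mem_univ i)
  refine (mul_eq_zero.1 this).resolve_right fun h0 => hi (mem_activeSet.2 ?_)
  simp only [Pi.sub_apply] at h0
  linarith

lemma IsKKT.multiplier_unique {x : Fin n → ℝ} {l l' : Fin m → ℝ} (hL : P.LICQ x)
    (h : P.IsKKT x l) (h' : P.IsKKT x l') : l = l' := by
  have e := extendZero_restrict fun i hi => h.eq_zero_of_notMem (i := i) hi
  have e' := extendZero_restrict fun i hi => h'.eq_zero_of_notMem (i := i) hi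
  have hA : P.Aᵀ *ᵥ l = P.Aᵀ *ᵥ l' := add_left_cancel (h.1.trans h'.1.symm)
  rw [← e, ← e', ← transpose_rows_mulVec, ← transpose_rows_mulVec, Matrix.mulVec_transpose,
    Matrix.mulVec_transpose] at hA
  rw [← e, ← e', Matrix.vecMul_injective_iff.2 hL hA]

/-- For linearly independent active constraints, a variational solution has multipliers. -/
lemma IsSolution.exists_isKKT {x : Fin n → ℝ} (hx : P.IsSolution x) (hL : P.LICQ x) :
    ∃ l, P.IsKKT x l := by
  set S := P.activeSet x with hS
  -- LICQ makes Farkas' lemma unnecessary: a vector `v` in the kernel of the active rows is a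
  -- feasible direction both ways, so the gradient is orthogonal to it and the Fredholm alternative
  -- gives `μ`.
  obtain ⟨μ, hμ⟩ := (P.rows S)ᵀ.exists_mulVec_eq (-(P.H *ᵥ x + P.f)) fun v hv => by
    rw [Matrix.vecMul_transpose] at hv
    have hv' : ∀ i ∈ P.activeSet x, (P.A *ᵥ v) i = 0 := fun i hi => congrFun hv ⟨i, hi⟩
    have h1 := dotProduct_nonneg_of_direction hx.1 hx.2 (d := v) fun i hi => (hv' i hi).le
    have h2 := dotProduct_nonneg_of_direction hx.1 hx.2 (d := -v) fun i hi => by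
      simp [Matrix.mulVec_neg, hv' i hi]
    rw [dotProduct_neg] at h2
    rw [dotProduct_comm, neg_dotProduct]
    linarith
  have hμ0 : ∀ j, 0 ≤ μ j := fun j => by
    -- A direction that leaves the constraint `j` alone among the active ones; along it the gradient
    -- has the product `μ j`.
    obtain ⟨d, hd⟩ := Matrix.exists_mulVec_eq_of_linearIndependent_row hL (-Pi.single j 1)
    have h1 := dotProduct_nonneg_of_direction hx.1 hx.2 (d := d) fun i hi => by
      have : (P.A *ᵥ d) i = (-Pi.single j 1 : S → ℝ) ⟨i, hi⟩ := congrFun hd ⟨i, hi⟩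
      rw [this, Pi.neg_apply, neg_nonpos]
      exact (Pi.single_nonneg.2 zero_le_one : (0 : S → ℝ) ≤ Pi.single j 1) _
    rw [← neg_neg (P.H *ᵥ x + P.f), ← hμ, neg_dotProduct, Matrix.mulVec_transpose,
      ← Matrix.dotProduct_mulVec] at h1
    have hd' : P.rows S *ᵥ d = -Pi.single j 1 := hd
    simpa [hd'] using h1
  refine ⟨extendZero S μ, ?_, fun i => ?_, fun i => by simpa using hx.1 i, ?_⟩
  · rw [← transpose_rows_mulVec, hμ, add_neg_cancel]
  · by_cases hi : i ∈ S <;> simp [extendZero, hi, hμ0]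
  · refine Finset.sum_eq_zero fun i _ => ?_
    by_cases hi : i ∈ S
    · simp [mem_activeSet.1 hi]
    · simp [extendZero, hi]

/-! ### The linear system of the Newton step. -/

lemma solvesKKTSystem_iff {S : Finset (Fin m)} {x : Fin n → ℝ} {μ : S → ℝ} :
    P.SolvesKKTSystem S x μ ↔
      P.H *ᵥ x + P.Aᵀ *ᵥ extendZero S μ = -P.f ∧ ∀ i ∈ S, (P.A *ᵥ x) i = P.b i := by
  rw [SolvesKKTSystem, Matrix.fromBlocks_mulVec, ← transpose_rows_mulVec]
  simp only [Sum.elim_comp_inl, Sum.elim_comp_inr, Matrix.zero_mulVec, add_zero]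
  constructor
  · intro h
    exact ⟨funext fun i => congrFun h (Sum.inl i), fun i hi => congrFun h (Sum.inr ⟨i, hi⟩)⟩
  · rintro ⟨h1, h2⟩
    rw [h1]
    congr 1
    exact funext fun i => h2 i i.2

/-- The matrix may be singular, but the system is consistent. A left null vector has first block
zero by definiteness of `H`; its second block is then orthogonal to the range of `P.rows S`, which
contains the right-hand side because `y` attains these constraints. -/
lemma exists_solvesKKTSystem (hH : (P.H + P.Hᵀ).PosDef) {S : Finset (Fin m)} {y : Fin n → ℝ}
    (hy : ∀ i ∈ S, (P.A *ᵥ y) i = P.b i) : ∃ x μ, P.SolvesKKTSystem S x μ := by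
  obtain ⟨w, hw⟩ := (Matrix.fromBlocks P.H (P.rows S)ᵀ (P.rows S) 0).exists_mulVec_eq
    (Sum.elim (-P.f) (fun i : S => P.b i)) fun v hv => by
      obtain ⟨v₁, v₂, rfl⟩ : ∃ v₁ v₂, v = Sum.elim v₁ v₂ :=
        ⟨v ∘ Sum.inl, v ∘ Sum.inr, (Sum.elim_comp_inl_inr v).symm⟩
      rw [Matrix.vecMul_fromBlocks] at hv
      simp only [Sum.elim_comp_inl, Sum.elim_comp_inr, Matrix.vecMul_zero, add_zero,
        Matrix.vecMul_transpose] at hv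
      have h1 : v₁ ᵥ* P.H + v₂ ᵥ* P.rows S = 0 := funext fun i => congrFun hv (Sum.inl i)
      have h2 : P.rows S *ᵥ v₁ = 0 := funext fun i => congrFun hv (Sum.inr i)
      have hv₁ : v₁ = 0 := eq_zero_of_dotProduct_H_nonpos hH (by
        have := congrArg (· ⬝ᵥ v₁) h1
        simp only [add_dotProduct, ← Matrix.dotProduct_mulVec, h2, dotProduct_zero, add_zero,
          zero_dotProduct] at this
        exact this.le)
      have hb : (fun i : S => P.b i) = P.rows S *ᵥ y := funext fun i => (hy i i.2).symm
      rw [hv₁, Matrix.zero_vecMul, zero_add] at h1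
      rw [sumElim_dotProduct_sumElim, hv₁, zero_dotProduct, zero_add, hb,
        Matrix.dotProduct_mulVec, h1, zero_dotProduct]
  exact ⟨w ∘ Sum.inl, w ∘ Sum.inr, by rw [SolvesKKTSystem, Sum.elim_comp_inl_inr, hw]⟩

/-- Dependent rows leave the multiplier undetermined, but the difference of two points lies in the
kernel of the rows while `H` maps it into their span, so its `H`-form vanishes. -/
lemma SolvesKKTSystem.unique (hH : (P.H + P.Hᵀ).PosDef) {S : Finset (Fin m)}
    {x x' : Fin n → ℝ} {μ μ' : S → ℝ} (h : P.SolvesKKTSystem S x μ)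
    (h' : P.SolvesKKTSystem S x' μ') : x = x' := by
  rw [solvesKKTSystem_iff, ← transpose_rows_mulVec] at h h'
  refine sub_eq_zero.1 (eq_zero_of_dotProduct_H_nonpos hH (le_of_eq ?_))
  have hA : P.rows S *ᵥ (x - x') = 0 := funext fun i => by
    rw [Matrix.mulVec_sub, Pi.sub_apply, rows_mulVec_apply, rows_mulVec_apply, h.2 i i.2,
      h'.2 i i.2, sub_self, Pi.zero_apply]
  have hE : P.H *ᵥ (x - x') = (P.rows S)ᵀ *ᵥ (μ' - μ) := by
    rw [Matrix.mulVec_sub, Matrix.mulVec_sub, sub_eq_sub_iff_add_eq_add, h.1, add_comm, h'.1]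
  rw [hE, Matrix.dotProduct_mulVec, Matrix.vecMul_transpose, hA, zero_dotProduct]

lemma SolvesKKTSystem.isKKT {S : Finset (Fin m)} {x : Fin n → ℝ} {μ : S → ℝ}
    (h : P.SolvesKKTSystem S x μ) (hfeas : 0 ≤ μ ∧ P.A *ᵥ x ≤ P.b) :
    P.IsKKT x (extendZero S μ) := by
  rw [solvesKKTSystem_iff] at h
  refine ⟨?_, fun i => ?_, fun i => by simpa using hfeas.2 i, ?_⟩
  · rw [add_right_comm, h.1, neg_add_cancel]
  · by_cases hi : i ∈ S
    · simpa [extendZero, hi] using hfeas.1 ⟨i, hi⟩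
    · simp [extendZero, hi]
  · refine Finset.sum_eq_zero fun i _ => ?_
    by_cases hi : i ∈ S
    · simp [h.2 i hi]
    · simp [extendZero, hi]

/-- At the active set of the solution, the linear system returns the KKT pair. -/
lemma IsKKT.feasible_of_solvesKKTSystem (hH : (P.H + P.Hᵀ).PosDef) {x z : Fin n → ℝ}
    {l : Fin m → ℝ} (h : P.IsKKT x l) (hL : P.LICQ x) {S : Finset (Fin m)}
    (hS : S = P.activeSet x) {μ : S → ℝ} (hs : P.SolvesKKTSystem S z μ) :
    0 ≤ μ ∧ P.A *ᵥ z ≤ P.b := by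
  subst hS
  have hs' : P.SolvesKKTSystem (P.activeSet x) x (fun i => l i) := by
    rw [solvesKKTSystem_iff, extendZero_restrict fun i hi => h.eq_zero_of_notMem hi]
    refine ⟨?_, fun i hi => mem_activeSet.1 hi⟩
    have h1 := h.1
    rw [add_right_comm] at h1
    exact eq_neg_of_add_eq_zero_left h1
  obtain rfl := hs.unique hH hs'
  refine ⟨fun i => ?_, h.isSolution.1⟩
  have hμ : μ = fun i : P.activeSet z => l i := by
    rw [solvesKKTSystem_iff, ← transpose_rows_mulVec] at hs hs'
    refine Matrix.vecMul_injective_iff.2 hL ?_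
    have := add_left_cancel (hs.1.trans hs'.1.symm)
    rwa [Matrix.mulVec_transpose, Matrix.mulVec_transpose] at this
  rw [hμ]
  exact h.2.1 i

/-- Finite identification of the active set under LICQ and strict complementarity. -/
lemma IsKKT.eventually_activeSet_eq {x : Fin n → ℝ} {l : Fin m → ℝ} (h : P.IsKKT x l)
    (hL : P.LICQ x) (hl : ∀ i ∈ P.activeSet x, 0 < l i) {z y : ℕ → Fin n → ℝ}
    (hyz : ∀ k, P.IsQPStationary ρ (z k) (y k)) (hz : Tendsto z atTop (𝓝 x))
    (hy : Tendsto y atTop (𝓝 x)) : ∀ᶠ k in atTop, P.activeSet (y k) = P.activeSet x := by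
  -- Constraints inactive at `x` stay inactive nearby, by continuity.
  have hsub : ∀ᶠ k in atTop, ∀ i ∉ P.activeSet x, i ∉ P.activeSet (y k) := by
    rw [eventually_all]
    intro i
    by_cases hi : i ∈ P.activeSet x
    · simp [hi]
    have hlt : (P.A *ᵥ x) i < P.b i :=
      lt_of_le_of_ne (h.isSolution.1 i) (fun h => hi (mem_activeSet.2 h))
    have hc : Continuous fun v : Fin n → ℝ => (P.A *ᵥ v) i := by fun_prop
    filter_upwards [((hc.tendsto x).comp hy).eventually_lt_const hlt] with k hk _
    rw [mem_activeSet]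
    exact hk.ne
  have hd : ∀ j : P.activeSet x, ∃ d, P.rows (P.activeSet x) *ᵥ d = Pi.single j 1 :=
    fun j => Matrix.exists_mulVec_eq_of_linearIndependent_row hL _
  choose d hd using hd
  -- At `x` this product is `-l j`, negative by strict complementarity. If `j` were inactive at `y
  -- k`, then `d j` would be a feasible direction there and the product would be nonnegative.
  have hneg : ∀ᶠ k in atTop, ∀ j, (P.Ht ρ *ᵥ y k + P.ft ρ (z k)) ⬝ᵥ d j < 0 := by
    rw [eventually_all]
    intro j
    have hlim : Tendsto (fun k => (P.Ht ρ *ᵥ y k + P.ft ρ (z k)) ⬝ᵥ d j) atTop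
        (𝓝 ((P.Ht ρ *ᵥ x + P.ft ρ x) ⬝ᵥ d j)) := by
      have h1 : Continuous fun v : Fin n → ℝ => P.Ht ρ *ᵥ v := by fun_prop
      have h2 : Continuous (P.ft ρ) := by unfold ft; fun_prop
      have h3 : Continuous fun v : Fin n → ℝ => v ⬝ᵥ d j := by fun_prop
      have h4 := ((h1.tendsto x).comp hy).add ((h2.tendsto x).comp hz)
      exact (h3.tendsto _).comp h4
    refine hlim.eventually_lt_const ?_
    rw [Ht_mulVec_add_ft, eq_neg_of_add_eq_zero_left h.1,
      ← extendZero_restrict fun i hi => h.eq_zero_of_notMem (i := i) hi,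
      ← transpose_rows_mulVec, neg_dotProduct, Matrix.mulVec_transpose,
      ← Matrix.dotProduct_mulVec, hd]
    simpa using hl j j.2
  filter_upwards [hsub, hneg] with k h1 h2
  have hsub' : P.activeSet (y k) ⊆ P.activeSet x := fun i hi => by
    by_contra hi'
    exact h1 i hi' hi
  refine hsub'.antisymm fun j hj => ?_
  by_contra hjk
  refine (h2 ⟨j, hj⟩).not_ge
    (dotProduct_nonneg_of_direction (hyz k).1 (hyz k).2 fun i hi => ?_)
  have hij : i ≠ j := fun e => hjk (e ▸ hi)
  have := congrFun (hd ⟨j, hj⟩) ⟨i, hsub' hi⟩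
  rw [rows_mulVec_apply, Pi.single_eq_of_ne (by simpa using hij)] at this
  exact this.le

/-! ### Termination of the hybrid method. -/

/-- The multiplier, the only free choice, can decide whether the method returns, but the next state
depends only on the points, which are unique. -/
lemma Step.next_unique (hρ : 0 < ρ) (hX : P.feasible.Nonempty) (hH : (P.H + P.Hᵀ).PosDef)
    {s s₁ s₂ : State n m} (h₁ : P.Step ρ s (.next s₁)) (h₂ : P.Step ρ s (.next s₂)) :
    s₁ = s₂ := by
  have hy : ∀ {z y}, P.IsQPSolution ρ z y → y = P.qpSol ρ z := fun h => h.eq_qpSol hρ hX hH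
  cases h₁ with
  | unstable y₁ hy₁ hp₁ =>
    obtain rfl := hy hy₁
    cases h₂ with
    | unstable y₂ hy₂ hp₂ => obtain rfl := hy hy₂; rfl
    | accept y₂ hy₂ hp₂ => obtain rfl := hy hy₂; exact absurd hp₂ hp₁
    | reject y₂ hy₂ hp₂ => obtain rfl := hy hy₂; exact absurd hp₂ hp₁
  | accept y₁ hy₁ hp₁ zt₁ μ₁ hs₁ _ yt₁ hyt₁ hδ₁ =>
    obtain rfl := hy hy₁
    obtain rfl := hy hyt₁
    cases h₂ with
    | unstable y₂ hy₂ hp₂ => obtain rfl := hy hy₂; exact absurd hp₁ hp₂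
    | accept y₂ hy₂ hp₂ zt₂ μ₂ hs₂ _ yt₂ hyt₂ hδ₂ =>
      obtain rfl := hy hy₂
      obtain rfl := hy hyt₂
      obtain rfl := hs₁.unique hH hs₂
      rfl
    | reject y₂ hy₂ hp₂ zt₂ μ₂ hs₂ _ yt₂ hyt₂ hδ₂ =>
      obtain rfl := hy hy₂
      obtain rfl := hy hyt₂
      obtain rfl := hs₁.unique hH hs₂
      exact absurd hδ₁ hδ₂
  | reject y₁ hy₁ hp₁ zt₁ μ₁ hs₁ _ yt₁ hyt₁ hδ₁ =>
    obtain rfl := hy hy₁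
    obtain rfl := hy hyt₁
    cases h₂ with
    | unstable y₂ hy₂ hp₂ => obtain rfl := hy hy₂; exact absurd hp₁ hp₂
    | accept y₂ hy₂ hp₂ zt₂ μ₂ hs₂ _ yt₂ hyt₂ hδ₂ =>
      obtain rfl := hy hy₂
      obtain rfl := hy hyt₂
      obtain rfl := hs₁.unique hH hs₂
      exact absurd hδ₂ hδ₁
    | reject y₂ hy₂ hp₂ zt₂ μ₂ hs₂ _ yt₂ hyt₂ hδ₂ =>
      obtain rfl := hy hy₂
      obtain rfl := hy hyt₂
      obtain rfl := hs₁.unique hH hs₂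
      rfl

lemma exists_step (hρ : 0 < ρ) (hX : P.feasible.Nonempty) (hH : (P.H + P.Hᵀ).PosDef)
    (s : State n m) : ∃ o, P.Step ρ s o := by
  have hy := isQPSolution_qpSol hρ hX hH s.z
  by_cases hp : s.prev = some (P.activeSet (P.qpSol ρ s.z))
  · obtain ⟨zt, μ, hs⟩ := exists_solvesKKTSystem hH
      (fun i (hi : i ∈ P.activeSet (P.qpSol ρ s.z)) => mem_activeSet.1 hi)
    have hyt := isQPSolution_qpSol hρ hX hH zt
    by_cases hf : 0 ≤ μ ∧ P.A *ᵥ zt ≤ P.b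
    · exact ⟨_, .terminate _ hy hp zt μ hs hf⟩
    by_cases hδ : euclNorm (P.qpSol ρ zt - zt) < s.δ
    · exact ⟨_, .accept _ hy hp zt μ hs hf _ hyt hδ⟩
    · exact ⟨_, .reject _ hy hp zt μ hs hf _ hyt hδ⟩
  · exact ⟨_, .unstable _ hy hp⟩

/-- Since the next state is unique, termination from every successor bounds all executions. -/
lemma exists_returnsWithin_of_step (hρ : 0 < ρ) (hX : P.feasible.Nonempty)
    (hH : (P.H + P.Hᵀ).PosDef) {x : Fin n → ℝ} {l : Fin m → ℝ} {s : State n m}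
    (h : ∀ o, P.Step ρ s o →
      o = .done x l ∨ ∃ s', o = .next s' ∧ ∃ N, P.ReturnsWithin ρ x l N s') :
    ∃ N, P.ReturnsWithin ρ x l N s := by
  by_cases hn : ∃ s', P.Step ρ s (.next s')
  · obtain ⟨s', hs'⟩ := hn
    obtain hd | ⟨_, he, N, hN⟩ := h _ hs'
    · cases hd
    cases he
    refine ⟨N + 1, exists_step hρ hX hH s, fun o ho => ?_⟩
    obtain hd | ⟨s'', rfl, -⟩ := h o ho
    · exact Or.inl hd
    · exact Or.inr ⟨s'', rfl, Step.next_unique hρ hX hH hs' ho ▸ hN⟩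
  · refine ⟨1, exists_step hρ hX hH s, fun o ho => ?_⟩
    obtain hd | ⟨s'', rfl, -⟩ := h o ho
    · exact Or.inl hd
    · exact absurd ⟨s'', ho⟩ hn

open Classical in
/-- The index sets whose linear system yields a point with residual below `δ`. -/
noncomputable def acceptableSets (P : AVI n m) (ρ : ℝ) (δ : ℝ≥0∞) : Finset (Finset (Fin m)) :=
  Finset.univ.filter fun S =>
    ∃ x μ, P.SolvesKKTSystem S x μ ∧ euclNorm (P.qpSol ρ x - x) < δ

/-- After acceptance `δ` equals the residual of the candidate of `S`, so the strict inequality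
excludes `S` itself: the cardinality is a termination measure. -/
lemma acceptableSets_ssubset (hH : (P.H + P.Hᵀ).PosDef) {S : Finset (Fin m)} {x : Fin n → ℝ}
    {μ : S → ℝ} (h : P.SolvesKKTSystem S x μ) {δ : ℝ≥0∞}
    (hδ : euclNorm (P.qpSol ρ x - x) < δ) :
    P.acceptableSets ρ (euclNorm (P.qpSol ρ x - x)) ⊂ P.acceptableSets ρ δ := by
  rw [Finset.ssubset_iff_of_subset]
  · refine ⟨S, by simpa [acceptableSets] using ⟨x, ⟨μ, h⟩, hδ⟩, ?_⟩
    simp only [acceptableSets, Finset.mem_filter, Finset.mem_univ, true_and]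
    rintro ⟨x', μ', h', hlt⟩
    obtain rfl := h.unique hH h'
    exact lt_irrefl _ hlt
  · intro T
    simp only [acceptableSets, Finset.mem_filter, Finset.mem_univ, true_and]
    rintro ⟨x', μ', h', hlt⟩
    exact ⟨x', μ', h', hlt.trans hδ⟩

/-- The hybrid method terminates from every state. -/
lemma IsKKT.exists_returnsWithin (hρ : 0 < ρ) (hX : P.feasible.Nonempty)
    (hH : (P.H + P.Hᵀ).PosDef) {x : Fin n → ℝ} {l : Fin m → ℝ} (h : P.IsKKT x l)
    (hL : P.LICQ x) (hl : ∀ i ∈ P.activeSet x, 0 < l i) (s : State n m) :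
    ∃ N, P.ReturnsWithin ρ x l N s := by
  have hy : ∀ {z y}, P.IsQPSolution ρ z y → y = P.qpSol ρ z := fun h => h.eq_qpSol hρ hX hH
  have hdone : ∀ {S : Finset (Fin m)} {zt : Fin n → ℝ} {μ : S → ℝ},
      P.SolvesKKTSystem S zt μ → 0 ≤ μ ∧ P.A *ᵥ zt ≤ P.b →
      (Outcome.done zt (extendZero S μ) : Outcome n m) = .done x l := by
    intro S zt μ hs hf
    have hk := hs.isKKT hf
    obtain rfl := hk.isSolution.unique hH h.isSolution
    rw [hk.multiplier_unique hL h]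
  -- The outer induction counts the candidates that can still be accepted. The inner one is on an
  -- index `K` from which the plain iteration started at `s.z` has the right active set. It holds
  -- for every stored set, so overwriting that set in a rejected step is harmless.
  induction hc : (P.acceptableSets ρ s.δ).card using Nat.strong_induction_on generalizing s with
  | _ c ih =>
  obtain ⟨hz, hqp⟩ := h.isSolution.tendsto_iterate hρ hX hH s.z
  obtain ⟨K, hK⟩ := eventually_atTop.1 (h.eventually_activeSet_eq hL hl
    (fun k => isQPStationary_qpSol hρ hX hH ((P.drMap ρ)^[k] s.z)) hz hqp)
  clear hz hqp
  induction K generalizing s with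
  | zero =>
    have hact : ∀ k, P.activeSet (P.qpSol ρ ((P.drMap ρ)^[k] s.z)) = P.activeSet x :=
      fun k => hK k (Nat.zero_le k)
    -- Once the right set is also the stored one, the test succeeds and every solution of the system
    -- is feasible, so the method must return.
    have hlast : ∀ t : State n m, P.activeSet (P.qpSol ρ t.z) = P.activeSet x →
        t.prev = some (P.activeSet x) → ∃ N, P.ReturnsWithin ρ x l N t := by
      intro t ht hp
      refine exists_returnsWithin_of_step hρ hX hH fun o ho => Or.inl ?_
      cases ho with
      | unstable y hqy hprev =>
        obtain rfl := hy hqy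
        exact absurd (ht ▸ hp) hprev
      | terminate y hqy hprev zt μ hs hf => exact hdone hs hf
      | accept y hqy hprev zt μ hs hf =>
        obtain rfl := hy hqy
        exact absurd (h.feasible_of_solvesKKTSystem hH hL ht hs) hf
      | reject y hqy hprev zt μ hs hf =>
        obtain rfl := hy hqy
        exact absurd (h.feasible_of_solvesKKTSystem hH hL ht hs) hf
    by_cases hp : s.prev = some (P.activeSet x)
    · exact hlast s (hact 0) hp
    -- With another set stored, only a plain step is possible; it stores the right set, and `hlast`
    -- applies to the next state.
    refine exists_returnsWithin_of_step hρ hX hH fun o ho => Or.inr ?_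
    have h0 : P.activeSet (P.qpSol ρ s.z) = P.activeSet x := hact 0
    have hne : ∀ {y}, P.IsQPSolution ρ s.z y → s.prev ≠ some (P.activeSet y) := by
      intro y hqy
      rw [hy hqy, h0]
      exact hp
    cases ho with
    | unstable y hqy hprev =>
      obtain rfl := hy hqy
      exact ⟨_, rfl, hlast _ (hact 1) (congrArg some h0)⟩
    | terminate y hqy hprev => exact absurd hprev (hne hqy)
    | accept y hqy hprev => exact absurd hprev (hne hqy)
    | reject y hqy hprev => exact absurd hprev (hne hqy)
  | succ K ihK =>
    have hK' : ∀ k ≥ K,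
        P.activeSet (P.qpSol ρ ((P.drMap ρ)^[k] (P.drMap ρ s.z))) = P.activeSet x :=
      fun k hk => hK (k + 1) (Nat.succ_le_succ hk)
    refine exists_returnsWithin_of_step hρ hX hH fun o ho => ?_
    cases ho with
    | unstable y hqy hprev =>
      obtain rfl := hy hqy
      exact Or.inr ⟨_, rfl, ihK _ hc hK'⟩
    | terminate y hqy hprev zt μ hs hf => exact Or.inl (hdone hs hf)
    | accept y hqy hprev zt μ hs hf yt hyt hδ =>
      obtain rfl := hy hyt
      -- Acceptance moves `z` off the plain orbit, so `K` is lost and chosen anew; only the outer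
      -- measure drops.
      refine Or.inr ⟨_, rfl, ih _ ?_ _ rfl⟩
      rw [← hc]
      exact Finset.card_lt_card (acceptableSets_ssubset hH hs hδ)
    | reject y hqy hprev zt μ hs hf yt hyt hδ =>
      obtain rfl := hy hqy
      exact Or.inr ⟨_, rfl, ihK _ hc hK'⟩

end AVI

theorem theorem2 {n m : ℕ} (P : AVI n m) (ρ : ℝ) (hρ : 0 < ρ)
    (hX : P.feasible.Nonempty)
    (hH : (P.H + P.Hᵀ).PosDef)
    (hLICQ : ∀ x, P.IsSolution x → P.LICQ x)
    (hSC : ∀ x l, P.IsKKT x l → ∀ i ∈ P.activeSet x, 0 < l i) :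
    ∃ (xs : Fin n → ℝ) (ls : Fin m → ℝ),
      (∀ x, P.IsSolution x ↔ x = xs) ∧
      (∀ x l, P.IsKKT x l ↔ x = xs ∧ l = ls) ∧
      ∀ (z₀ : Fin n → ℝ) (S₀ : Option (Finset (Fin m))),
        ∃ N : ℕ, P.ReturnsWithin ρ xs ls N ⟨z₀, S₀, ⊤⟩ := by
  obtain ⟨xs, hxs⟩ := AVI.exists_isSolution hX hH
  obtain ⟨ls, hls⟩ := hxs.exists_isKKT (hLICQ xs hxs)
  refine ⟨xs, ls, fun x => ⟨fun hx => hx.unique hH hxs, fun hx => hx ▸ hxs⟩, fun x l => ?_,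
    fun z₀ S₀ => hls.exists_returnsWithin hρ hX hH (hLICQ xs hxs) (hSC xs ls hls) _⟩
  constructor
  · intro hx
    obtain rfl := hx.isSolution.unique hH hxs
    exact ⟨rfl, hx.multiplier_unique (hLICQ _ hxs) hls⟩
  · rintro ⟨rfl, rfl⟩
    exact hls
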